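/- **Proposition 6.** Let $X$ be a Polish space with a non-zero, $\sigma$-finite, non-atomic Borel measure $m$ and let $T:X\to X$ be measurable with $m\circ T^{-1}=m$. Call a collection $R$ of Borel sets of finite measure a *dense, $T$-invariant, hereditary ring* if it contains $\emptyset$ and is closed under finite unions and differences; every Borel subset of a member of $R$ is in $R$; $A\in R$ implies $T^{-1}A\in R$; and for every Borel set $A$ with $m(A)<\infty$ and every $\epsilon>0$ there is $B\in R$ with $m(A\triangle B)<\epsilon$. Suppose that $(X,m,T)$ is weakly rationally ergodic, with the dense, $T$-invariant, hereditary ring $R(T)$ and the return sequence $a(n)>0$ $(n\ge1)$, i.e. $$\frac1{a(n)}\sum_{k=0}^{n-1}m(A\cap T^{-k}B)\xrightarrow[n\to\infty]{}m(A)m(B)\qquad\forall\ A,B\in R(T).$$ Write $S_n(f):=\sum_{k=0}^{n-1}f\circ T^k$ and $m(f):=\int_X f\,dm$, and suppose that for every $f\in L^1(m)$, $S_n(f)/a(n)\to m(f)$ in measure on every set of finite measure. Then, for all $f\in L^1(m)$ with $f\ge0$, all bounded continuous $g:[0,\infty)\to\mathbb R$ and all $A,B\in R(T)$, $$\frac1{a(n)}\sum_{k=1}^n\left|\int_A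 g\!\left(\tfrac{S_k(f)}{a(k)}\right)1_B\circ T^k\,dm-g(m(f))\,m(A\cap T^{-k}B)\right|\xrightarrow[n\to\infty]{}0.$$ If, in addition, $(X,m,T)$ is rationally weakly mixing with weights $u_n\in\mathbb R$ $(n\ge 1)$, i.e. for all $A,B$ in some dense, $T$-invariant, hereditary ring, $$\sum_{n=1}^N\left|m(A\cap T^{-n}B)-m(A)m(B)u_n\right|=o\Big(\sum_{n=1}^Nu_n\Big)\quad\text{as } N\to\infty,$$ then $a(N)\sim\sum_{n=1}^Nu_n$ and, for all $f\in L^1(m)$ with $f\ge0$, all bounded continuous $g:[0,\infty)\to\mathbb R$ and all $B,C\in R(T)$, $$\frac1{a(N)}\sum_{n=1}^N\left|\int_{B\cap T^{-n}C}g\!\left(\tfrac{S_n(f)}{a(n)}\right)dm-m(B)m(C)\,g(m(f))\,u_n\right|\xrightarrow[N\to\infty]{}0.$$ -/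

import Mathlib

open MeasureTheory Filter Topology Asymptotics
open scoped NNReal BoundedContinuousFunction symmDiff

/-- A `T`-invariant hereditary ring `R` of measurable sets of finite `m`-measure which is dense in
the sets of finite measure (with respect to the distance `m (A ∆ B)`). -/
structure IsDenseInvariantHereditaryRing {X : Type*} [MeasurableSpace X] (m : Measure X)
    (T : X → X) (R : Set (Set X)) : Prop where
  isSetRing : IsSetRing R
  measurableSet : ∀ A ∈ R, MeasurableSet A
  measure_lt_top : ∀ A ∈ R, m A < ⊤
  hereditary : ∀ A ∈ R, ∀ B, MeasurableSet B → B ⊆ A → B ∈ R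
  invariant : ∀ A ∈ R, T ⁻¹' A ∈ R
  dense : ∀ A, MeasurableSet A → m A < ⊤ → ∀ ε : ENNReal, 0 < ε → ∃ B ∈ R, m (A ∆ B) < ε

/-- `(X, m, T)` is weakly rationally ergodic with ring `R = R(T)` and return sequence
`a(n) = a_n(T)`. -/
structure IsWeaklyRationallyErgodic {X : Type*} [MeasurableSpace X] (m : Measure X)
    (T : X → X) (R : Set (Set X)) (a : ℕ → ℝ) : Prop where
  measurePreserving : MeasurePreserving T m m
  ring : IsDenseInvariantHereditaryRing m T R
  pos : ∀ n, 1 ≤ n → 0 < a n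
  tendsto : ∀ A ∈ R, ∀ B ∈ R,
    Tendsto (fun n : ℕ => (1 / a n) * ∑ k ∈ Finset.range n, m.real (A ∩ T^[k] ⁻¹' B))
      atTop (𝓝 (m.real A * m.real B))

/-- `(X, m, T)` is rationally weakly mixing with weights `u n`: for `A`, `B` in a dense,
`T`-invariant, hereditary ring,
`∑_{n ≤ N} |m(A ∩ T⁻ⁿ B) - m(A) m(B) u_n| = o(∑_{n ≤ N} u_n)`. -/
def IsRationallyWeaklyMixing {X : Type*} [MeasurableSpace X] (m : Measure X)
    (T : X → X) (u : ℕ → ℝ) : Prop :=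
  MeasurePreserving T m m ∧
  ∃ R : Set (Set X), IsDenseInvariantHereditaryRing m T R ∧
    ∀ A ∈ R, ∀ B ∈ R,
      (fun N : ℕ => ∑ n ∈ Finset.Icc 1 N,
          |m.real (A ∩ T^[n] ⁻¹' B) - m.real A * m.real B * u n|)
        =o[atTop] (fun N : ℕ => ∑ n ∈ Finset.Icc 1 N, u n)

/-- Convergence in measure on every set of finite measure (the usual meaning of convergence in
measure when `m` is an infinite, σ-finite measure). -/
def TendstoInMeasureOnFinite {X : Type*} [MeasurableSpace X] (m : Measure X)
    (F : ℕ → X → ℝ) (F₀ : X → ℝ) : Prop :=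
  ∀ A, MeasurableSet A → m A < ⊤ → TendstoInMeasure (m.restrict A) F atTop F₀

/-! Since `f ≥ 0`, the sums `S_k(f)` increase in `k`, so two good times control all times between
them. If `a` varies by a factor close to 1 over a block of times, and `S/a` is close to `c = m(f)`
at both ends of the block at a point `x`, then `S_k(f)/a(k)` is close to `c` at `x` for every `k` in
the block. Hence deviations inside a block only come from points of `A` that are bad at an end, a
set `E n` with `m(E n) → 0` by convergence in measure.

Visits to `B` from `E n` are `o(a(n))`: `S_n(1_B)/a(n) → m(B)` in `L¹(A)`, by a Scheffé argument
from convergence in measure and weak rational ergodicity, so these functions are uniformly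
integrable on `A`. Blocks shrink `a` geometrically, so bad visits over the whole past are `o(a(n))`
as well (`tendsto_sum_deviation_div`). At good visits continuity of `g` at `c` suffices; at bad
ones, boundedness.

For rational weak mixing, a set common to both rings gives `a(N) ~ ∑ u_n`. Approximation from inside
carries the mixing estimate over to `R`, and the triangle inequality combines it with the first
part. -/

/-! ### Geometric blocks of times -/

/-- If the block sums of `φ` over `(p n, n)`, with `b (p n) ≤ b n / l` and `l > 1`, are `o (b n)`,
then so are the full sums. -/
theorem tendsto_sum_range_div_of_block {b φ : ℕ → ℝ} {l M : ℝ} {p : ℕ → ℕ} (hb0 : ∀ n, 0 ≤ b n)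
    (hb : Tendsto b atTop atTop) (hl : 1 < l) (hφ0 : ∀ n, 0 ≤ φ n) (hφM : ∀ n, φ n ≤ M)
    (hp : ∀ᶠ n in atTop, p n < n ∧ b (p n) ≤ b n / l)
    (hblock : Tendsto (fun n => (∑ k ∈ Finset.Ico (p n + 1) n, φ k) / b n) atTop (𝓝 0)) :
    Tendsto (fun n => (∑ k ∈ Finset.range n, φ k) / b n) atTop (𝓝 0) := by
  -- The factor `l / (l - 1) = 1 + 1/l + 1/l² + ⋯` is the geometric series met on iterating `n ↦ p
  -- n`; `C` absorbs the finitely many initial `n`.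
  have key : ∀ ε > 0, ∃ C, ∀ n, ∑ k ∈ Finset.range n, φ k ≤ C + ε * (l / (l - 1)) * b n := by
    intro ε hε
    have h1 : ∀ᶠ n in atTop, (∑ k ∈ Finset.Ico (p n + 1) n, φ k) / b n < ε / 2 :=
      hblock.eventually_lt_const (by positivity)
    -- Half of `ε` pays for the block, half for the single time `p n`, which lies in neither range.
    have h2 : ∀ᶠ n in atTop, max (M / (ε / 2)) 1 ≤ b n := hb.eventually_ge_atTop _
    obtain ⟨N, hN⟩ := eventually_atTop.1 (h1.and (h2.and hp))
    refine ⟨∑ k ∈ Finset.range N, φ k, fun n => ?_⟩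
    induction n using Nat.strong_induction_on with
    | _ n ih =>
      have hl' : 0 < l - 1 := by linarith
      rcases lt_or_ge n N with h | h
      · have : ∑ k ∈ Finset.range n, φ k ≤ ∑ k ∈ Finset.range N, φ k :=
          Finset.sum_le_sum_of_subset_of_nonneg (by simpa using h.le) (fun i _ _ => hφ0 i)
        have h3 : 0 ≤ ε * (l / (l - 1)) * b n := by
          have := hb0 n
          positivity
        linarith
      · obtain ⟨h1, h2, h3, h4⟩ := hN n h
        have hbn : 0 < b n := lt_of_lt_of_le (by norm_num) ((le_max_right _ _).trans h2)
        have h5 : M ≤ ε / 2 * b n := by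
          have := (le_max_left _ _).trans h2
          rw [div_le_iff₀ (by positivity)] at this
          linarith
        rw [div_lt_iff₀ hbn] at h1
        have h6 : ∑ k ∈ Finset.range n, φ k = ∑ k ∈ Finset.range (p n), φ k + φ (p n)
            + ∑ k ∈ Finset.Ico (p n + 1) n, φ k := by
          rw [← Finset.sum_range_succ, Finset.sum_range_add_sum_Ico _ h3]
        have h7 := ih (p n) h3
        have h8 : ε * (l / (l - 1)) * b (p n) ≤ ε * (l / (l - 1)) * (b n / l) := by gcongr
        have h9 : ε * (l / (l - 1)) * (b n / l) + ε * b n = ε * (l / (l - 1)) * b n := by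
          field_simp
          ring
        have := hφM (p n)
        linarith
  rw [Metric.tendsto_atTop']
  have hl' : 0 < l - 1 := by linarith
  intro ε hε
  obtain ⟨C, hC⟩ := key (ε / 2 / (l / (l - 1))) (by positivity)
  have h1 : ∀ᶠ n in atTop, max (C / (ε / 2) + 1) 1 ≤ b n := hb.eventually_ge_atTop _
  obtain ⟨N, hN⟩ := eventually_atTop.1 h1
  refine ⟨N, fun n hn => ?_⟩
  have h2 := hN n hn.le
  have hbn : 0 < b n := lt_of_lt_of_le (by norm_num) ((le_max_right _ _).trans h2)
  have h3 : C < ε / 2 * b n := by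
    have : C / (ε / 2) < b n := by linarith [(le_max_left _ _).trans h2]
    rw [div_lt_iff₀ (by positivity)] at this
    linarith
  have h4 := hC n
  rw [div_mul_cancel₀ _ (by positivity)] at h4
  rw [Real.dist_0_eq_abs, abs_of_nonneg (div_nonneg (Finset.sum_nonneg fun i _ => hφ0 i) hbn.le),
    div_lt_iff₀ hbn]
  linarith

/-- For a sequence `a` asymptotic to a monotone sequence `b` tending to infinity, the values of `a`
over a block `(p n, n]` with `b (p n) ≤ b n / l` are comparable up to a factor close to one. -/
theorem exists_block_start {a b : ℕ → ℝ} {l : ℝ} (hmono : Monotone b) (hb0 : b 0 = 0)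
    (hb : Tendsto b atTop atTop) (ha : ∀ n, 1 ≤ n → 0 < a n)
    (hab : Tendsto (fun n => b n / a n) atTop (𝓝 1)) (hl : 1 < l) :
    ∃ p : ℕ → ℕ, Tendsto p atTop atTop ∧ (∀ᶠ n in atTop, p n < n ∧ b (p n) ≤ b n / l) ∧
      ∀ᶠ n in atTop, ∀ k, p n + 1 ≤ k → k ≤ n →
        a n ≤ l ^ 3 * a k ∧ a k ≤ l ^ 3 * a (p n + 1) := by
  classical
  have hl0 : 0 < l := by linarith
  have hbn : ∀ n, 0 ≤ b n := fun n => hb0 ▸ hmono (Nat.zero_le n)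
  -- Maximality gives `b n < l * b (p n + 1)`, so `b` varies by less than `l` over `(p n, n]`.
  -- Passing from `a` to `b` and back costs another `l` each way, whence `l ^ 3`.
  let p : ℕ → ℕ := fun n => Nat.findGreatest (fun k => b k ≤ b n / l) n
  have hp1 : ∀ n, b (p n) ≤ b n / l := fun n => by
    refine Nat.findGreatest_spec (P := fun k => b k ≤ b n / l) (Nat.zero_le n) ?_
    have := hbn n
    rw [hb0]
    positivity
  have hp2 : ∀ n, 0 < b n → p n < n := fun n h => by
    refine lt_of_le_of_ne (Nat.findGreatest_le n) fun h' => ?_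
    have := hp1 n
    rw [h', le_div_iff₀ hl0] at this
    nlinarith
  have hp3 : ∀ n, 0 < b n → b n < l * b (p n + 1) := fun n h => by
    have := Nat.findGreatest_is_greatest (P := fun k => b k ≤ b n / l) (Nat.lt_succ_self (p n))
      (hp2 n h)
    rw [not_le, div_lt_iff₀ hl0] at this
    linarith
  have hpt : Tendsto p atTop atTop := by
    rw [tendsto_atTop]
    intro N
    filter_upwards [hb.eventually_ge_atTop (l * b N), eventually_ge_atTop N] with n h1 h2
    refine Nat.le_findGreatest h2 ?_
    rw [le_div_iff₀ hl0]
    linarith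
  have hpos := hb.eventually_gt_atTop 0
  refine ⟨p, hpt, hpos.mono fun n h => ⟨hp2 n h, hp1 n⟩, ?_⟩
  have hup : ∀ᶠ n in atTop, b n ≤ l * a n := by
    filter_upwards [hab.eventually_lt_const hl, eventually_ge_atTop 1] with n h1 h2
    rw [div_lt_iff₀ (ha n h2)] at h1
    exact h1.le
  have hlow : ∀ᶠ n in atTop, a n ≤ l * b n := by
    have : l⁻¹ < 1 := inv_lt_one_of_one_lt₀ hl
    filter_upwards [hab.eventually_const_lt this, eventually_ge_atTop 1] with n h1 h2
    rw [lt_div_iff₀ (ha n h2), inv_mul_lt_iff₀ hl0] at h1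
    exact h1.le
  obtain ⟨N, hN⟩ := eventually_atTop.1 (hup.and hlow)
  filter_upwards [hpos, hpt.eventually_ge_atTop N] with n hn hpn k hk1 hk2
  have h1 : b n < l * b (p n + 1) := hp3 n hn
  have h2 : b (p n + 1) ≤ b k := hmono hk1
  have h3 : b k ≤ b n := hmono hk2
  have h4 := (hN n (by omega)).2
  have h5 := hN k (by omega)
  have h6 := (hN (p n + 1) (by omega)).1
  constructor
  · calc a n ≤ l * b n := h4
      _ ≤ l * (l * (l * a k)) := by gcongr; nlinarith
      _ = l ^ 3 * a k := by ring
  · calc a k ≤ l * b k := h5.2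
      _ ≤ l * (l * (l * a (p n + 1))) := by gcongr; nlinarith
      _ = l ^ 3 * a (p n + 1) := by ring

/-! ### From convergence in measure to `L¹` -/

/-- A Scheffé-type lemma for convergence in measure to a constant. -/
theorem tendsto_integral_abs_sub_const {X : Type*} [MeasurableSpace X] {μ : Measure X}
    [IsFiniteMeasure μ] {h : ℕ → X → ℝ} {c : ℝ} (hc : 0 ≤ c) (hint : ∀ n, Integrable (h n) μ)
    (h0 : ∀ᶠ n in atTop, ∀ x, 0 ≤ h n x) (hm : ∀ n, Measurable (h n))
    (hconv : TendstoInMeasure μ h atTop fun _ => c)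
    (hmean : Tendsto (fun n => ∫ x, h n x ∂μ) atTop (𝓝 (μ.real Set.univ * c))) :
    Tendsto (fun n => ∫ x, |h n x - c| ∂μ) atTop (𝓝 0) := by
  have hset : ∀ (δ : ℝ) n, MeasurableSet {x | δ ≤ |h n x - c|} := fun δ n =>
    measurableSet_le measurable_const (((hm n).sub_const c).abs)
  have hneg_int : ∀ n, Integrable (fun x => max (c - h n x) 0) μ := fun n =>
    ((integrable_const c).sub (hint n)).pos_part
  -- Because `|h - c| = (h - c) + 2 (c - h)⁺`, only the negative part needs an estimate; it is
  -- bounded by `c` as `h ≥ 0`, so convergence in measure suffices.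
  have hneg : Tendsto (fun n => ∫ x, max (c - h n x) 0 ∂μ) atTop (𝓝 0) := by
    rw [tendsto_order]
    refine ⟨fun r hr => Eventually.of_forall fun n =>
      hr.trans_le (integral_nonneg fun x => le_max_right _ _), fun r hr => ?_⟩
    set V := μ.real Set.univ with hV
    have hV0 : 0 ≤ V := measureReal_nonneg
    set δ := r / (2 * (V + 1)) with hδ
    have hδ0 : 0 < δ := by positivity
    have h1 : Tendsto (fun n => c * μ.real {x | δ ≤ |h n x - c|}) atTop (𝓝 (c * 0)) := by
      refine Tendsto.const_mul _ ?_
      have := tendstoInMeasure_iff_measureReal_norm.1 hconv δ hδ0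
      simpa [Real.norm_eq_abs] using this
    rw [mul_zero] at h1
    filter_upwards [h0, h1.eventually_lt_const (half_pos hr)] with n hn0 hn
    calc ∫ x, max (c - h n x) 0 ∂μ
        ≤ ∫ x, (δ + {x | δ ≤ |h n x - c|}.indicator (fun _ => c) x) ∂μ := by
          refine integral_mono (hneg_int n) ((integrable_const δ).add
            ((integrable_const c).indicator (hset δ n))) fun x => ?_
          simp only [Set.indicator_apply, Set.mem_ofPred_eq]
          split_ifs with hx
          · exact max_le (by linarith [hn0 x]) (by positivity)
          · rw [not_le, abs_lt] at hx
            exact max_le (by linarith [hx.1]) (by positivity)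
      _ = V * δ + c * μ.real {x | δ ≤ |h n x - c|} := by
          rw [integral_add (integrable_const δ) ((integrable_const c).indicator (hset δ n)),
            integral_indicator_const _ (hset δ n), integral_const]
          simp [hV, mul_comm]
      _ < r := by
          have : V * δ ≤ r / 2 := by
            rw [hδ, ← mul_div_assoc, div_le_div_iff₀ (by positivity) (by positivity)]
            nlinarith
          linarith
  have heq : ∀ n, ∫ x, |h n x - c| ∂μ
      = (∫ x, h n x ∂μ - μ.real Set.univ * c) + 2 * ∫ x, max (c - h n x) 0 ∂μ := fun n => by
    have : (∫ x, h n x ∂μ - μ.real Set.univ * c) = ∫ x, (h n x - c) ∂μ := by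
      rw [integral_sub (hint n) (integrable_const c), integral_const, smul_eq_mul]
    rw [this, ← integral_const_mul, ← integral_add (f := fun x => h n x - c)
      ((hint n).sub (integrable_const c)) ((hneg_int n).const_mul 2)]
    congr 1
    ext x
    rcases le_total (h n x) c with hx | hx
    · rw [abs_of_nonpos (by linarith), max_eq_left (by linarith)]; ring
    · rw [abs_of_nonneg (by linarith), max_eq_right (by linarith)]; ring
  simp_rw [heq]
  simpa using (hmean.sub_const (μ.real Set.univ * c)).add (hneg.const_mul 2)

/-! ### Small sets and inner approximation in a dense hereditary ring -/

/-- Heredity lets a dense approximant be cut down to `A`. Approximating from inside later allows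
passage between two different rings. -/
theorem IsDenseInvariantHereditaryRing.exists_subset_sdiff_lt {X : Type*} [MeasurableSpace X]
    {m : Measure X} {T : X → X} {R : Set (Set X)} (hR : IsDenseInvariantHereditaryRing m T R)
    {A : Set X} (hA : MeasurableSet A) (hAm : m A < ⊤) {ε : ℝ} (hε : 0 < ε) :
    ∃ B ∈ R, B ⊆ A ∧ m.real (A \ B) < ε := by
  obtain ⟨B, hB, hAB⟩ := hR.dense A hA hAm (ENNReal.ofReal ε) (by simpa using hε)
  refine ⟨A ∩ B, hR.hereditary B hB _ (hA.inter (hR.measurableSet B hB)) Set.inter_subset_right,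
    Set.inter_subset_left, ?_⟩
  have h1 : m (A \ (A ∩ B)) ≤ m (A ∆ B) := by
    rw [Set.sdiff_self_inter]
    exact measure_mono Set.subset_union_left
  exact ENNReal.toReal_lt_of_lt_ofReal (h1.trans_lt hAB)

/-- A non-atomic measure charges arbitrarily small sets. -/
theorem exists_subset_measure_pos_lt {X : Type*} [TopologicalSpace X] [PolishSpace X]
    [MeasurableSpace X] [BorelSpace X] (m : Measure X) [NullSingletonClass m] {A : Set X}
    (hA : MeasurableSet A) (hA0 : m A ≠ 0) (hAm : m A < ⊤) {ε : ENNReal} (hε : 0 < ε) :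
    ∃ B ⊆ A, MeasurableSet B ∧ 0 < m B ∧ m B < ε := by
  let _ := TopologicalSpace.upgradeIsCompletelyMetrizable X
  -- Every neighbourhood of `x` meets `A` in positive measure, while outer regularity of the finite
  -- measure `m.restrict A` at the null set `{x}` makes one such intersection small.
  obtain ⟨x, -, hx⟩ := exists_mem_forall_mem_nhdsWithin_pos_measure hA0
  have : IsFiniteMeasure (m.restrict A) := ⟨by simpa using hAm⟩
  have h0 : m.restrict A {x} < ε := by
    have : m.restrict A {x} ≤ m {x} := Measure.restrict_apply_le A {x}
    exact (this.trans_eq (measure_singleton x)).trans_lt hε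
  obtain ⟨U, hU, hUo, hUm⟩ := Set.exists_isOpen_lt_of_lt {x} ε h0
  rw [Measure.restrict_apply hUo.measurableSet] at hUm
  refine ⟨U ∩ A, Set.inter_subset_right, hUo.measurableSet.inter hA, hx _ ?_, hUm⟩
  rw [Set.inter_comm]
  exact inter_mem self_mem_nhdsWithin
    (mem_nhdsWithin_of_mem_nhds (hUo.mem_nhds (hU (Set.mem_singleton x))))

theorem IsDenseInvariantHereditaryRing.exists_measureReal_pos_lt {X : Type*} [TopologicalSpace X]
    [PolishSpace X] [MeasurableSpace X] [BorelSpace X] {m : Measure X} [SigmaFinite m]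
    [NullSingletonClass m] (hm : m ≠ 0) {T : X → X} {R : Set (Set X)}
    (hR : IsDenseInvariantHereditaryRing m T R) {ε : ℝ} (hε : 0 < ε) :
    ∃ A ∈ R, 0 < m.real A ∧ m.real A < ε := by
  obtain ⟨n, hn⟩ : ∃ n, m (spanningSets m n) ≠ 0 := by
    by_contra! h
    apply hm
    rw [← Measure.measure_univ_eq_zero, ← iUnion_spanningSets m]
    exact measure_iUnion_null h
  obtain ⟨B, -, hB, hB0, hBε⟩ := exists_subset_measure_pos_lt m (measurableSet_spanningSets m n) hn
    (measure_spanningSets_lt_top m n) (ε := ENNReal.ofReal ε) (by simpa using hε)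
  have hBt : m B < ⊤ := hBε.trans ENNReal.ofReal_lt_top
  have hBr : 0 < m.real B := ENNReal.toReal_pos hB0.ne' hBt.ne
  obtain ⟨C, hC, hCB, hlt⟩ := hR.exists_subset_sdiff_lt hB hBt hBr
  refine ⟨C, hC, ?_, (measureReal_mono hCB hBt.ne).trans_lt
    (ENNReal.toReal_lt_of_lt_ofReal hBε)⟩
  rw [measureReal_sdiff hCB (hR.measurableSet C hC) hBt.ne] at hlt
  linarith

theorem birkhoffSum_indicator_eq {X : Type*} (T : X → X) (B : Set X) (n : ℕ) (x : X) :
    birkhoffSum T (B.indicator fun _ => (1 : ℝ)) n x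
      = ∑ k ∈ Finset.range n, (T^[k] ⁻¹' B).indicator (fun _ => (1 : ℝ)) x := rfl

/-! ### The return sequence and uniform integrability of visits -/

namespace IsWeaklyRationallyErgodic

variable {X : Type*} [MeasurableSpace X] {m : Measure X} {T : X → X} {R : Set (Set X)} {a : ℕ → ℝ}

theorem tendsto_div (hT : IsWeaklyRationallyErgodic m T R a) {A B : Set X} (hA : A ∈ R)
    (hB : B ∈ R) :
    Tendsto (fun n : ℕ => (∑ k ∈ Finset.range n, m.real (A ∩ T^[k] ⁻¹' B)) / a n)
      atTop (𝓝 (m.real A * m.real B)) := by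
  simpa only [one_div, inv_mul_eq_div] using hT.tendsto A hA B hB

theorem measurableSet_preimage_iterate (hT : IsWeaklyRationallyErgodic m T R a) {B : Set X}
    (hB : MeasurableSet B) (k : ℕ) : MeasurableSet (T^[k] ⁻¹' B) :=
  hT.measurePreserving.measurable.iterate k hB

/-- The return sequence tends to infinity. -/
theorem tendsto_atTop [TopologicalSpace X] [PolishSpace X] [BorelSpace X] [SigmaFinite m]
    [NullSingletonClass m] (hm : m ≠ 0) (hT : IsWeaklyRationallyErgodic m T R a) :
    Tendsto a atTop atTop := by
  rw [Filter.tendsto_atTop]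
  intro M
  set M' := max M 1 with hM'
  have hM0 : 0 < M' := lt_of_lt_of_le one_pos (le_max_right _ _)
  obtain ⟨A, hA, hA0, hAlt⟩ := hT.ring.exists_measureReal_pos_lt hm (ε := 1 / (2 * M'))
    (by positivity)
  have h1 := (hT.tendsto_div hA hA).eventually_lt_const
    (show m.real A * m.real A < 2 * (m.real A * m.real A) by nlinarith)
  filter_upwards [h1, eventually_ge_atTop 1] with n hn hn1
  have ha := hT.pos n hn1
  -- The term `k = 0` alone is `m(A)`, so `m(A) < 2 m(A)² a(n)`: arbitrarily small `A` force `a` to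
  -- infinity.
  have h2 : m.real A ≤ ∑ k ∈ Finset.range n, m.real (A ∩ T^[k] ⁻¹' A) := by
    have := Finset.single_le_sum (f := fun k => m.real (A ∩ T^[k] ⁻¹' A))
      (fun i _ => measureReal_nonneg) (Finset.mem_range.2 (show 0 < n by omega))
    simpa using this
  rw [div_lt_iff₀ ha] at hn
  have h3 : 1 < 2 * m.real A * a n := by
    by_contra! h
    nlinarith
  have h4 : 2 * m.real A < 1 / M' := by
    rw [lt_div_iff₀ (by positivity)] at hAlt ⊢
    linarith
  have h5 : 1 < 1 / M' * a n := h3.trans (by gcongr)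
  rw [one_div, lt_inv_mul_iff₀ hM0, mul_one] at h5
  exact (le_max_left M 1).trans h5.le

theorem measurable_birkhoffSum (hT : IsWeaklyRationallyErgodic m T R a) {f : X → ℝ}
    (hf : Measurable f) (n : ℕ) : Measurable (birkhoffSum T f n) :=
  Finset.measurable_sum _ fun k _ => hf.comp (hT.measurePreserving.measurable.iterate k)

theorem integrable_birkhoffSum (hT : IsWeaklyRationallyErgodic m T R a) {f : X → ℝ}
    (hf : Integrable f m) (n : ℕ) : Integrable (birkhoffSum T f n) m :=
  integrable_finsetSum _ fun k _ => (hT.measurePreserving.iterate k).integrable_comp_of_integrable hf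

theorem setIntegral_birkhoffSum_indicator (hT : IsWeaklyRationallyErgodic m T R a) {B E : Set X}
    (hB : MeasurableSet B) (hBm : m B < ⊤) (n : ℕ) :
    ∫ x in E, birkhoffSum T (B.indicator fun _ => (1 : ℝ)) n x ∂m
      = ∑ k ∈ Finset.range n, m.real (E ∩ T^[k] ⁻¹' B) := by
  simp_rw [birkhoffSum_indicator_eq]
  rw [integral_finsetSum]
  · refine Finset.sum_congr rfl fun k _ => ?_
    have hk := hT.measurableSet_preimage_iterate hB k
    rw [integral_indicator_const _ hk, smul_eq_mul, mul_one, measureReal_restrict_apply hk,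
      Set.inter_comm]
  · intro k _
    have hk := hT.measurableSet_preimage_iterate hB k
    refine (IntegrableOn.integrable_indicator ?_ hk).restrict
    refine integrableOn_const ?_
    rw [(hT.measurePreserving.iterate k).measure_preimage hB.nullMeasurableSet]
    exact hBm.ne

/-- `S_n(1_B) / a(n) → m(B)` in `L¹(A)`. -/
theorem tendsto_setIntegral_abs_sub (hT : IsWeaklyRationallyErgodic m T R a)
    (hconv : ∀ f : X → ℝ, Integrable f m →
      TendstoInMeasureOnFinite m (fun n x => birkhoffSum T f n x / a n) (fun _ => ∫ x, f x ∂m))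
    {A B : Set X} (hA : A ∈ R) (hB : B ∈ R) :
    Tendsto (fun n => ∫ x in A,
      |birkhoffSum T (B.indicator fun _ => (1 : ℝ)) n x / a n - m.real B| ∂m) atTop (𝓝 0) := by
  have hBm := hT.ring.measurableSet B hB
  have hBt := hT.ring.measure_lt_top B hB
  have hAm := hT.ring.measurableSet A hA
  have hAt := hT.ring.measure_lt_top A hA
  have : IsFiniteMeasure (m.restrict A) := ⟨by simpa using hAt⟩
  have hint : Integrable (B.indicator fun _ => (1 : ℝ)) m :=
    (integrableOn_const hBt.ne).integrable_indicator hBm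
  refine tendsto_integral_abs_sub_const measureReal_nonneg
    (fun n => ((hT.integrable_birkhoffSum hint n).div_const _).restrict) ?_
    (fun n => (hT.measurable_birkhoffSum (measurable_const.indicator hBm) n).div_const _) ?_ ?_
  · filter_upwards [eventually_ge_atTop 1] with n hn x
    refine div_nonneg ?_ (hT.pos n hn).le
    exact Finset.sum_nonneg fun k _ => Set.indicator_nonneg (fun _ _ => zero_le_one) _
  · have := hconv _ hint A hAm hAt
    rwa [integral_indicator_const _ hBm, smul_eq_mul, mul_one] at this
  -- Convergence of the means is exactly weak rational ergodicity.
  · simp_rw [integral_div, hT.setIntegral_birkhoffSum_indicator hBm hBt]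
    simpa [measureReal_def] using hT.tendsto_div hA hB

/-- Uniform integrability of the normalized return times: visits to `B` starting from subsets of
`A` of vanishing measure are negligible. -/
theorem tendsto_sum_inter_div_zero (hT : IsWeaklyRationallyErgodic m T R a)
    (hconv : ∀ f : X → ℝ, Integrable f m →
      TendstoInMeasureOnFinite m (fun n x => birkhoffSum T f n x / a n) (fun _ => ∫ x, f x ∂m))
    {A B : Set X} (hA : A ∈ R) (hB : B ∈ R) {E : ℕ → Set X}
    (hEA : ∀ n, E n ⊆ A)
    (hE : Tendsto (fun n => m.real (E n)) atTop (𝓝 0)) :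
    Tendsto (fun n => (∑ k ∈ Finset.range n, m.real (E n ∩ T^[k] ⁻¹' B)) / a n)
      atTop (𝓝 0) := by
  have hBm := hT.ring.measurableSet B hB
  have hBt := hT.ring.measure_lt_top B hB
  have hAm := hT.ring.measurableSet A hA
  have hAt := hT.ring.measure_lt_top A hA
  have hint : Integrable (B.indicator fun _ => (1 : ℝ)) m :=
    (integrableOn_const hBt.ne).integrable_indicator hBm
  have hlim := (hE.mul_const (m.real B)).add (hT.tendsto_setIntegral_abs_sub hconv hA hB)
  rw [zero_mul, zero_add] at hlim
  refine squeeze_zero' ?_ ?_ hlim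
  · filter_upwards [eventually_ge_atTop 1] with n hn
    exact div_nonneg (Finset.sum_nonneg fun k _ => measureReal_nonneg) (hT.pos n hn).le
  · refine Eventually.of_forall fun n => ?_
    rw [← hT.setIntegral_birkhoffSum_indicator hBm hBt, ← integral_div]
    have hi : Integrable (fun x => birkhoffSum T (B.indicator fun _ => (1 : ℝ)) n x / a n) m :=
      (hT.integrable_birkhoffSum hint n).div_const _
    have hEt : m (E n) ≠ ⊤ := ((measure_mono (hEA n)).trans_lt hAt).ne
    have hc : ∀ s, m s ≠ ⊤ → IntegrableOn (fun _ : X => m.real B) s m :=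
      fun s hs => integrableOn_const hs
    have habs : IntegrableOn (fun x => |birkhoffSum T (B.indicator fun _ => (1 : ℝ)) n x / a n
        - m.real B|) A m := (hi.integrableOn.sub (hc A hAt.ne)).abs
    calc ∫ x in E n, birkhoffSum T (B.indicator fun _ => (1 : ℝ)) n x / a n ∂m
        ≤ ∫ x in E n, (m.real B + |birkhoffSum T (B.indicator fun _ => (1 : ℝ)) n x / a n
            - m.real B|) ∂m := by
          refine integral_mono hi.restrict ((hc _ hEt).add (habs.mono_set (hEA n))) fun x => ?_
          have := le_abs_self (birkhoffSum T (B.indicator fun _ => (1 : ℝ)) n x / a n - m.real B)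
          dsimp only
          linarith
      _ = m.real (E n) * m.real B + ∫ x in E n,
            |birkhoffSum T (B.indicator fun _ => (1 : ℝ)) n x / a n - m.real B| ∂m := by
          rw [integral_add (hc _ hEt) (habs.mono_set (hEA n)), setIntegral_const, smul_eq_mul]
      _ ≤ _ := by
          refine add_le_add le_rfl ?_
          exact setIntegral_mono_set habs (Eventually.of_forall fun x => abs_nonneg _)
            (LE.le.eventuallyLE (hEA n))

end IsWeaklyRationallyErgodic

/-! ### Rarity of deviations at visits -/

theorem birkhoffSum_mono_of_nonneg {X : Type*} (T : X → X) {f : X → ℝ} (hf : ∀ x, 0 ≤ f x) (x : X) :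
    Monotone fun n => birkhoffSum T f n x := fun _ _ hij =>
  Finset.sum_le_sum_of_subset_of_nonneg (Finset.range_mono hij) fun _ _ _ => hf _

/-- Perturbing `c` by `t` and by a factor `(1 + t)^3` stays within `ε` for some `t > 0`. -/
theorem exists_pos_perturb_lt (c : ℝ) {ε : ℝ} (hε : 0 < ε) :
    ∃ t > 0, (1 + t) ^ 3 * (c + t) < c + ε ∧ (1 + t) ^ 3 * (c - ε) < c - t := by
  have h1 : Tendsto (fun t : ℝ => (1 + t) ^ 3 * (c + t)) (𝓝[>] 0) (𝓝 c) := by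
    have : Continuous fun t : ℝ => (1 + t) ^ 3 * (c + t) := by fun_prop
    simpa using (this.tendsto 0).mono_left nhdsWithin_le_nhds
  have h2 : Tendsto (fun t : ℝ => (1 + t) ^ 3 * (c - ε) + t) (𝓝[>] 0) (𝓝 (c - ε)) := by
    have : Continuous fun t : ℝ => (1 + t) ^ 3 * (c - ε) + t := by fun_prop
    simpa using (this.tendsto 0).mono_left nhdsWithin_le_nhds
  obtain ⟨t, ht1, ht2, ht3⟩ := ((h1.eventually_lt_const (show c < c + ε by linarith)).and
    ((h2.eventually_lt_const (show c - ε < c by linarith)).and self_mem_nhdsWithin)).exists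
  exact ⟨t, ht3, ht1, by linarith⟩

namespace IsWeaklyRationallyErgodic

variable {X : Type*} [MeasurableSpace X] {m : Measure X} {T : X → X} {R : Set (Set X)} {a : ℕ → ℝ}

/-- A visit to `B` at a time `k` where `S_k(f) / a(k)` is away from `m(f)` is rare. -/
theorem tendsto_sum_deviation_div [TopologicalSpace X] [PolishSpace X] [BorelSpace X]
    [SigmaFinite m] [NullSingletonClass m] (hm : m ≠ 0) (hT : IsWeaklyRationallyErgodic m T R a)
    (hconv : ∀ f : X → ℝ, Integrable f m →
      TendstoInMeasureOnFinite m (fun n x => birkhoffSum T f n x / a n) (fun _ => ∫ x, f x ∂m))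
    {f : X → ℝ} (hf : Integrable f m) (hf0 : ∀ x, 0 ≤ f x)
    {A B : Set X} (hA : A ∈ R) (hB : B ∈ R) {ε : ℝ} (hε : 0 < ε) :
    Tendsto (fun n => (∑ k ∈ Finset.range n,
      m.real ((A ∩ {x | ε ≤ |birkhoffSum T f k x / a k - ∫ x, f x ∂m|}) ∩ T^[k] ⁻¹' B)) / a n)
      atTop (𝓝 0) := by
  set c := ∫ x, f x ∂m with hc
  have hAm := hT.ring.measurableSet A hA
  have hAt := hT.ring.measure_lt_top A hA
  -- The cube matches the loss `l ^ 3` of `exists_block_start` for `l = 1 + t`.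
  obtain ⟨t, ht0, htu, htl⟩ := exists_pos_perturb_lt c hε
  obtain ⟨A₀, hA₀, hA₀0, -⟩ := hT.ring.exists_measureReal_pos_lt hm one_pos
  -- The sequence `a` need not be monotone; `b` is a monotone substitute asymptotic to it.
  set b : ℕ → ℝ := fun n => (∑ k ∈ Finset.range n, m.real (A₀ ∩ T^[k] ⁻¹' A₀)) /
    (m.real A₀ * m.real A₀) with hb
  have hbmono : Monotone b := fun i j hij => by
    refine div_le_div_of_nonneg_right ?_ (by positivity)
    exact Finset.sum_le_sum_of_subset_of_nonneg (Finset.range_mono hij)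
      fun _ _ _ => measureReal_nonneg
  have hb0 : b 0 = 0 := by simp [hb]
  have hba : Tendsto (fun n => b n / a n) atTop (𝓝 1) := by
    have := (hT.tendsto_div hA₀ hA₀).div_const (m.real A₀ * m.real A₀)
    rw [div_self (by positivity)] at this
    refine this.congr fun n => ?_
    rw [hb, div_right_comm]
  have hbt : Tendsto b atTop atTop := by
    have := hba.pos_mul_atTop one_pos (hT.tendsto_atTop hm)
    refine this.congr' ?_
    filter_upwards [eventually_ge_atTop 1] with n hn
    rw [div_mul_cancel₀ _ (hT.pos n hn).ne']
  have hab : Tendsto (fun n => a n / b n) atTop (𝓝 1) := by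
    simpa using hba.inv₀ one_ne_zero
  obtain ⟨p, hpt, hp, hpa⟩ := exists_block_start hbmono hb0 hbt hT.pos hba
    (show 1 < 1 + t by linarith)
  have hbpos := hbt.eventually_gt_atTop 0
  set φ : ℕ → ℝ := fun k =>
    m.real ((A ∩ {x | ε ≤ |birkhoffSum T f k x / a k - c|}) ∩ T^[k] ⁻¹' B) with hφ
  set D : ℕ → Set X := fun n => A ∩ {x | t ≤ |birkhoffSum T f n x / a n - c|} with hD
  have hDt : Tendsto (fun n => m.real (D n)) atTop (𝓝 0) := by
    have : IsFiniteMeasure (m.restrict A) := ⟨by simpa using hAt⟩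
    have h1 := tendstoInMeasure_iff_measureReal_norm.1 (hconv f hf A hAm hAt) t ht0
    refine h1.congr fun n => ?_
    rw [measureReal_restrict_apply' hAm, Set.inter_comm]
    simp [hD, hc]
  -- The points bad at one of the two ends of the block; off `E n` the whole block is good.
  set E : ℕ → Set X := fun n => D (p n + 1) ∪ D n with hE
  have hEA : ∀ n, E n ⊆ A := fun n => Set.union_subset Set.inter_subset_left Set.inter_subset_left
  have hEt : Tendsto (fun n => m.real (E n)) atTop (𝓝 0) := by
    have h1 := (hDt.comp ((tendsto_add_atTop_nat 1).comp hpt)).add hDt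
    rw [add_zero] at h1
    exact squeeze_zero (fun n => measureReal_nonneg) (fun n => measureReal_union_le _ _) h1
  have hvisit := hT.tendsto_sum_inter_div_zero hconv hA hB hEA hEt
  have hblock : Tendsto (fun n => (∑ k ∈ Finset.Ico (p n + 1) n, φ k) / b n) atTop (𝓝 0) := by
    have h1 := hvisit.mul hab
    rw [zero_mul] at h1
    refine squeeze_zero' ?_ ?_ h1
    · filter_upwards [hbpos] with n hn
      exact div_nonneg (Finset.sum_nonneg fun _ _ => measureReal_nonneg) hn.le
    filter_upwards [hbpos, hpa, hp, eventually_ge_atTop 1] with n hbn hpa hp hn1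
    rw [div_mul_div_cancel₀ (hT.pos n hn1).ne']
    refine div_le_div_of_nonneg_right ?_ hbn.le
    calc ∑ k ∈ Finset.Ico (p n + 1) n, φ k
        ≤ ∑ k ∈ Finset.Ico (p n + 1) n, m.real (E n ∩ T^[k] ⁻¹' B) := by
          refine Finset.sum_le_sum fun k hk => ?_
          rw [Finset.mem_Ico] at hk
          refine measureReal_mono (Set.inter_subset_inter_left _ ?_)
            ((measure_mono (Set.inter_subset_left.trans (hEA n))).trans_lt hAt).ne
          rintro x ⟨hxA, hx⟩
          by_contra hxE
          have hq : x ∉ D (p n + 1) := fun h => hxE (Or.inl h)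
          have hn : x ∉ D n := fun h => hxE (Or.inr h)
          have hq' : |birkhoffSum T f (p n + 1) x / a (p n + 1) - c| < t :=
            not_le.1 fun h => hq ⟨hxA, h⟩
          have hn' : |birkhoffSum T f n x / a n - c| < t := not_le.1 fun h => hn ⟨hxA, h⟩
          obtain ⟨hak1, hak2⟩ := hpa k hk.1 hk.2.le
          have hk0 := hT.pos k (by omega)
          have hn0 := hT.pos n hn1
          have hq0 := hT.pos (p n + 1) (by omega)
          have hmq := birkhoffSum_mono_of_nonneg T hf0 x hk.1
          have hmn := birkhoffSum_mono_of_nonneg T hf0 x hk.2.le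
          simp only at hmq hmn
          rw [abs_lt] at hq' hn'
          have hqs : c - t < birkhoffSum T f (p n + 1) x / a (p n + 1) := by linarith
          have hns : birkhoffSum T f n x / a n < c + t := by linarith
          rw [lt_div_iff₀ hq0] at hqs
          rw [div_lt_iff₀ hn0] at hns
          have hct : 0 < c + t := by
            have : 0 ≤ c := integral_nonneg hf0
            linarith
          rw [Set.mem_ofPred_eq] at hx
          refine hx.not_gt (abs_lt.2 ⟨?_, ?_⟩)
          · suffices h : c - ε < birkhoffSum T f k x / a k by linarith
            rw [lt_div_iff₀ hk0]
            -- Inserting the upper bound for `a k` needs `c - ε ≥ 0`. Otherwise `S_k ≥ 0` suffices,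
            -- except at `c = ε`, where strictness comes from `S` at time `p n + 1`.
            rcases le_or_gt (c - ε) 0 with h | h
            · rcases h.lt_or_eq with h | h
              · exact (mul_neg_of_neg_of_pos h hk0).trans_le
                  (Finset.sum_nonneg fun _ _ => hf0 _)
              · rw [h, mul_zero] at htl
                rw [h, zero_mul]
                exact (mul_pos htl hq0).trans (hqs.trans_le hmq)
            · calc (c - ε) * a k ≤ (c - ε) * ((1 + t) ^ 3 * a (p n + 1)) := by gcongr
                _ = (1 + t) ^ 3 * (c - ε) * a (p n + 1) := by ring
                _ < (c - t) * a (p n + 1) := by gcongr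
                _ < _ := hqs.trans_le hmq
          · rw [sub_lt_iff_lt_add', div_lt_iff₀ hk0]
            calc birkhoffSum T f k x ≤ (c + t) * a n := hmn.trans hns.le
              _ ≤ (c + t) * ((1 + t) ^ 3 * a k) := by gcongr
              _ = (1 + t) ^ 3 * (c + t) * a k := by ring
              _ < (c + ε) * a k := by gcongr
      _ ≤ ∑ k ∈ Finset.range n, m.real (E n ∩ T^[k] ⁻¹' B) := by
          refine Finset.sum_le_sum_of_subset_of_nonneg ?_ fun _ _ _ => measureReal_nonneg
          intro k hk
          simpa using (Finset.mem_Ico.1 hk).2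
  have hfin := tendsto_sum_range_div_of_block (M := m.real A)
    (fun n => hb0 ▸ hbmono (Nat.zero_le n)) hbt (show 1 < 1 + t by linarith)
    (fun n => measureReal_nonneg)
    (fun n => measureReal_mono (Set.inter_subset_left.trans Set.inter_subset_left) hAt.ne)
    hp hblock
  have := hfin.mul hba
  rw [zero_mul] at this
  refine this.congr' ?_
  filter_upwards [hbpos] with n hn
  rw [div_mul_div_cancel₀ hn.ne']

end IsWeaklyRationallyErgodic

/-! ### The averaged statement -/

theorem sum_Icc_one_eq_sum_range_add (φ : ℕ → ℝ) (n : ℕ) :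
    ∑ k ∈ Finset.Icc 1 n, φ k = ∑ k ∈ Finset.range n, φ k + (φ n - φ 0) := by
  induction n with
  | zero => simp
  | succ n ih =>
    rw [Finset.sum_Icc_succ_top (by omega), Finset.sum_range_succ, ih]
    ring

namespace IsWeaklyRationallyErgodic

variable {X : Type*} [MeasurableSpace X] {m : Measure X} {T : X → X} {R : Set (Set X)} {a : ℕ → ℝ}

theorem measureReal_inter_preimage_le (hT : IsWeaklyRationallyErgodic m T R a) {A : Set X}
    (hA : A ∈ R) (B : Set X) (k : ℕ) : m.real (A ∩ T^[k] ⁻¹' B) ≤ m.real A :=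
  measureReal_mono Set.inter_subset_left (hT.ring.measure_lt_top A hA).ne

/-- Moving the window from `[0, n)` to `[1, n]` changes the sum by at most `m(A)`, negligible since
`a(n) → ∞`. -/
theorem tendsto_Icc_div (hT : IsWeaklyRationallyErgodic m T R a) (ha : Tendsto a atTop atTop)
    {A B : Set X} (hA : A ∈ R) (hB : B ∈ R) :
    Tendsto (fun n : ℕ => (∑ k ∈ Finset.Icc 1 n, m.real (A ∩ T^[k] ⁻¹' B)) / a n)
      atTop (𝓝 (m.real A * m.real B)) := by
  have hz : Tendsto (fun n => (m.real (A ∩ T^[n] ⁻¹' B) - m.real (A ∩ T^[0] ⁻¹' B)) / a n)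
      atTop (𝓝 0) := by
    rw [tendsto_zero_iff_abs_tendsto_zero]
    refine squeeze_zero' (Eventually.of_forall fun _ => abs_nonneg _) ?_
      (ha.const_div_atTop (m.real A))
    filter_upwards [eventually_ge_atTop 1] with n hn
    have h1 := hT.measureReal_inter_preimage_le hA B n
    have h2 := hT.measureReal_inter_preimage_le hA B 0
    have h3 : 0 ≤ m.real (A ∩ T^[n] ⁻¹' B) := measureReal_nonneg
    have h4 : 0 ≤ m.real (A ∩ T^[0] ⁻¹' B) := measureReal_nonneg
    simp only [Function.comp_apply]
    rw [abs_div, abs_of_pos (hT.pos n hn)]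
    exact div_le_div_of_nonneg_right (abs_le.2 ⟨by linarith, by linarith⟩) (hT.pos n hn).le
  have h := (hT.tendsto_div hA hB).add hz
  rw [add_zero] at h
  refine h.congr fun n => ?_
  rw [← add_div, sum_Icc_one_eq_sum_range_add]

/-- The averaged conclusion for measurable, everywhere nonnegative `f`. -/
theorem tendsto_sum_abs_setIntegral_sub_of_measurable [TopologicalSpace X] [PolishSpace X]
    [BorelSpace X] [SigmaFinite m] [NullSingletonClass m] (hm : m ≠ 0)
    (hT : IsWeaklyRationallyErgodic m T R a)
    (hconv : ∀ f : X → ℝ, Integrable f m →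
      TendstoInMeasureOnFinite m (fun n x => birkhoffSum T f n x / a n) (fun _ => ∫ x, f x ∂m))
    {f : X → ℝ} (hf : Integrable f m) (hfm : Measurable f) (hf0 : ∀ x, 0 ≤ f x) (g : ℝ≥0 →ᵇ ℝ)
    {A B : Set X} (hA : A ∈ R) (hB : B ∈ R) :
    Tendsto (fun n : ℕ => (∑ k ∈ Finset.Icc 1 n,
      |(∫ x in A ∩ T^[k] ⁻¹' B, g (birkhoffSum T f k x / a k).toNNReal ∂m)
        - g (∫ x, f x ∂m).toNNReal * m.real (A ∩ T^[k] ⁻¹' B)|) / a n) atTop (𝓝 0) := by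
  set c := ∫ x, f x ∂m with hc
  have hAm := hT.ring.measurableSet A hA
  have hAt := hT.ring.measure_lt_top A hA
  have hBm := hT.ring.measurableSet B hB
  have ha := hT.tendsto_atTop hm
  rw [tendsto_order]
  refine ⟨fun r hr => ?_, fun r hr => ?_⟩
  · filter_upwards [eventually_ge_atTop 1] with n hn
    exact hr.trans_le (div_nonneg (Finset.sum_nonneg fun _ _ => abs_nonneg _) (hT.pos n hn).le)
  set V := m.real A * m.real B with hV
  have hV0 : 0 ≤ V := mul_nonneg measureReal_nonneg measureReal_nonneg
  set w := r / (V + 1) with hw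
  have hw0 : 0 < w := by positivity
  have hgc : Continuous fun y : ℝ => g y.toNNReal := g.continuous.comp continuous_real_toNNReal
  obtain ⟨ε, hε, hgε⟩ := Metric.continuous_iff.1 hgc c w hw0
  set D : ℕ → Set X := fun k => {x | ε ≤ |birkhoffSum T f k x / a k - c|} with hD
  have hDm : ∀ k, MeasurableSet (D k) := fun k => measurableSet_le measurable_const
    ((((hT.measurable_birkhoffSum hfm k).div_const _).sub_const c).abs)
  -- Off `D k` continuity at `c` costs at most `w` per unit of mass; on `D k` the cost is at most `2
  -- * ‖g‖`.
  have hterm : ∀ k, |(∫ x in A ∩ T^[k] ⁻¹' B, g (birkhoffSum T f k x / a k).toNNReal ∂m)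
        - g c.toNNReal * m.real (A ∩ T^[k] ⁻¹' B)|
      ≤ w * m.real (A ∩ T^[k] ⁻¹' B) + 2 * ‖g‖ * m.real ((A ∩ D k) ∩ T^[k] ⁻¹' B) := by
    intro k
    have hset : MeasurableSet (A ∩ T^[k] ⁻¹' B) :=
      hAm.inter (hT.measurableSet_preimage_iterate hBm k)
    have hfin : m (A ∩ T^[k] ⁻¹' B) < ⊤ := (measure_mono Set.inter_subset_left).trans_lt hAt
    have : IsFiniteMeasure (m.restrict (A ∩ T^[k] ⁻¹' B)) := ⟨by simpa using hfin⟩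
    have hgm : Measurable fun x => g (birkhoffSum T f k x / a k).toNNReal :=
      hgc.measurable.comp ((hT.measurable_birkhoffSum hfm k).div_const _)
    have hgi : IntegrableOn (fun x => g (birkhoffSum T f k x / a k).toNNReal)
        (A ∩ T^[k] ⁻¹' B) m :=
      Integrable.of_bound hgm.aestronglyMeasurable ‖g‖
        (Eventually.of_forall fun x => g.norm_coe_le_norm _)
    have heq : (∫ x in A ∩ T^[k] ⁻¹' B, g (birkhoffSum T f k x / a k).toNNReal ∂m)
        - g c.toNNReal * m.real (A ∩ T^[k] ⁻¹' B)
        = ∫ x in A ∩ T^[k] ⁻¹' B,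
          (g (birkhoffSum T f k x / a k).toNNReal - g c.toNNReal) ∂m := by
      rw [integral_sub hgi (integrable_const _), setIntegral_const, smul_eq_mul, mul_comm]
    rw [heq]
    have hDi : IntegrableOn ((D k).indicator fun _ => 2 * ‖g‖) (A ∩ T^[k] ⁻¹' B) m :=
      (integrable_const _).indicator (hDm k)
    calc |∫ x in A ∩ T^[k] ⁻¹' B, (g (birkhoffSum T f k x / a k).toNNReal - g c.toNNReal) ∂m|
        ≤ ∫ x in A ∩ T^[k] ⁻¹' B, |g (birkhoffSum T f k x / a k).toNNReal - g c.toNNReal| ∂m :=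
          abs_integral_le_integral_abs
      _ ≤ ∫ x in A ∩ T^[k] ⁻¹' B, (w + (D k).indicator (fun _ => 2 * ‖g‖) x) ∂m := by
          refine integral_mono (hgi.sub (integrable_const _)).abs
            ((integrable_const w).add hDi) fun x => ?_
          by_cases hx : x ∈ D k
          · simp only [Set.indicator_of_mem hx]
            have h1 := g.norm_coe_le_norm (birkhoffSum T f k x / a k).toNNReal
            have h2 := g.norm_coe_le_norm c.toNNReal
            have h3 := norm_sub_le (g (birkhoffSum T f k x / a k).toNNReal) (g c.toNNReal)
            rw [Real.norm_eq_abs (_ - _)] at h3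
            linarith
          · simp only [Set.indicator_of_notMem hx, add_zero]
            have := hgε (birkhoffSum T f k x / a k) (by
              rw [Real.dist_eq]
              exact not_le.1 hx)
            exact this.le
      _ = w * m.real (A ∩ T^[k] ⁻¹' B) + 2 * ‖g‖ * m.real ((A ∩ D k) ∩ T^[k] ⁻¹' B) := by
          rw [integral_add (integrable_const w) hDi, setIntegral_const,
            integral_indicator_const _ (hDm k), measureReal_restrict_apply (hDm k), smul_eq_mul,
            smul_eq_mul, mul_comm, mul_comm (m.real _)]
          congr 3
          ext x
          simp only [Set.mem_inter_iff]
          tauto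
  have hbad := hT.tendsto_sum_deviation_div hm hconv hf hf0 hA hB hε
  have hlim : Tendsto (fun n => w * ((∑ k ∈ Finset.Icc 1 n, m.real (A ∩ T^[k] ⁻¹' B)) / a n)
      + 2 * ‖g‖ * ((∑ k ∈ Finset.range n, m.real ((A ∩ D k) ∩ T^[k] ⁻¹' B)) / a n
        + m.real A / a n)) atTop (𝓝 (w * V + 2 * ‖g‖ * (0 + 0))) :=
    ((hT.tendsto_Icc_div ha hA hB).const_mul w).add
      ((hbad.add (ha.const_div_atTop _)).const_mul _)
  have hlt : w * V + 2 * ‖g‖ * (0 + 0) < r := by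
    rw [add_zero, mul_zero, add_zero, hw, div_mul_eq_mul_div, div_lt_iff₀ (by positivity)]
    nlinarith
  filter_upwards [hlim.eventually_lt_const hlt, eventually_ge_atTop 1] with n hn hn1
  refine lt_of_le_of_lt ?_ hn
  have han := hT.pos n hn1
  rw [← add_div, mul_div_assoc', mul_div_assoc', ← add_div]
  refine div_le_div_of_nonneg_right ?_ han.le
  calc _ ≤ ∑ k ∈ Finset.Icc 1 n, (w * m.real (A ∩ T^[k] ⁻¹' B)
          + 2 * ‖g‖ * m.real ((A ∩ D k) ∩ T^[k] ⁻¹' B)) := Finset.sum_le_sum fun k _ => hterm k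
    _ = w * ∑ k ∈ Finset.Icc 1 n, m.real (A ∩ T^[k] ⁻¹' B)
          + 2 * ‖g‖ * ∑ k ∈ Finset.Icc 1 n, m.real ((A ∩ D k) ∩ T^[k] ⁻¹' B) := by
        rw [Finset.sum_add_distrib, ← Finset.mul_sum, ← Finset.mul_sum]
    _ ≤ _ := by
        gcongr
        rw [sum_Icc_one_eq_sum_range_add]
        gcongr
        refine (sub_le_self _ measureReal_nonneg).trans (measureReal_mono ?_ hAt.ne)
        exact Set.inter_subset_left.trans Set.inter_subset_left

/-- Changing `f` on a null set changes each `S_k(f)` only on a null set, because `T` preserves `m`;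
so `f` may be replaced by the positive part of a measurable representative. -/
theorem tendsto_sum_abs_setIntegral_sub [TopologicalSpace X] [PolishSpace X]
    [BorelSpace X] [SigmaFinite m] [NullSingletonClass m] (hm : m ≠ 0)
    (hT : IsWeaklyRationallyErgodic m T R a)
    (hconv : ∀ f : X → ℝ, Integrable f m →
      TendstoInMeasureOnFinite m (fun n x => birkhoffSum T f n x / a n) (fun _ => ∫ x, f x ∂m))
    {f : X → ℝ} (hf : Integrable f m) (hf0 : 0 ≤ᵐ[m] f) (g : ℝ≥0 →ᵇ ℝ)
    {A B : Set X} (hA : A ∈ R) (hB : B ∈ R) :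
    Tendsto (fun n : ℕ => (∑ k ∈ Finset.Icc 1 n,
      |(∫ x in A ∩ T^[k] ⁻¹' B, g (birkhoffSum T f k x / a k).toNNReal ∂m)
        - g (∫ x, f x ∂m).toNNReal * m.real (A ∩ T^[k] ⁻¹' B)|) / a n) atTop (𝓝 0) := by
  set f' : X → ℝ := fun x => max (hf.1.mk f x) 0 with hf'
  have hff' : f =ᵐ[m] f' := by
    filter_upwards [hf.1.ae_eq_mk, hf0] with x h1 h2
    rw [hf']
    simp only
    rw [← h1]
    exact (max_eq_left h2).symm
  have hS : ∀ k, birkhoffSum T f k =ᵐ[m] birkhoffSum T f' k := fun k => by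
    have h : ∀ᵐ x ∂m, ∀ i, f (T^[i] x) = f' (T^[i] x) := ae_all_iff.2 fun i =>
      (hT.measurePreserving.iterate i).quasiMeasurePreserving.ae_eq_comp hff'
    filter_upwards [h] with x hx
    exact Finset.sum_congr rfl fun i _ => hx i
  refine (hT.tendsto_sum_abs_setIntegral_sub_of_measurable hm hconv (hf.congr hff')
    (hf.1.stronglyMeasurable_mk.measurable.max measurable_const) (fun x => le_max_right _ _) g
    hA hB).congr fun n => ?_
  rw [integral_congr_ae hff']
  congr 1
  refine Finset.sum_congr rfl fun k _ => ?_
  congr 2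
  refine integral_congr_ae (ae_restrict_of_ae ?_)
  filter_upwards [hS k] with x hx
  rw [hx]

end IsWeaklyRationallyErgodic

/-! ### Rational weak mixing and its weights -/

namespace IsWeaklyRationallyErgodic

variable {X : Type*} [MeasurableSpace X] {m : Measure X} {T : X → X} {R : Set (Set X)} {a : ℕ → ℝ}

theorem isEquivalent_sum_Icc (hT : IsWeaklyRationallyErgodic m T R a)
    (ha : Tendsto a atTop atTop) {A : Set X} (hA : A ∈ R) (hA0 : 0 < m.real A) :
    (fun N => ∑ n ∈ Finset.Icc 1 N, m.real (A ∩ T^[n] ⁻¹' A)) ~[atTop]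
      fun N => m.real A * m.real A * a N := by
  refine isEquivalent_of_tendsto_one ?_
  have h := (hT.tendsto_Icc_div ha hA hA).div_const (m.real A * m.real A)
  rw [div_self (by positivity)] at h
  refine h.congr fun n => ?_
  simp only [Pi.div_apply]
  rw [div_div, mul_comm (a n)]

/-- The weights of rational weak mixing sum up to the return sequence. -/
theorem isEquivalent_sum_weights (hT : IsWeaklyRationallyErgodic m T R a)
    (ha : Tendsto a atTop atTop) {u : ℕ → ℝ} {A : Set X} (hA : A ∈ R) (hA0 : 0 < m.real A)
    (hu : (fun N : ℕ => ∑ n ∈ Finset.Icc 1 N,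
        |m.real (A ∩ T^[n] ⁻¹' A) - m.real A * m.real A * u n|)
      =o[atTop] (fun N : ℕ => ∑ n ∈ Finset.Icc 1 N, u n)) :
    a ~[atTop] (fun N : ℕ => ∑ n ∈ Finset.Icc 1 N, u n) := by
  have hv : m.real A * m.real A ≠ 0 := by positivity
  have h1 : (fun N => ∑ n ∈ Finset.Icc 1 N, m.real (A ∩ T^[n] ⁻¹' A)) ~[atTop]
      fun N => m.real A * m.real A * ∑ n ∈ Finset.Icc 1 N, u n := by
    rw [IsEquivalent, isLittleO_const_mul_right_iff hv]
    refine (IsBigO.of_bound 1 (Eventually.of_forall fun N => ?_)).trans_isLittleO hu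
    rw [one_mul, Pi.sub_apply, Finset.mul_sum, ← Finset.sum_sub_distrib, Real.norm_eq_abs]
    exact (Finset.abs_sum_le_sum_abs _ _).trans (le_abs_self _)
  have h2 := (IsEquivalent.refl (u := fun _ : ℕ => (m.real A * m.real A)⁻¹)).mul
    ((hT.isEquivalent_sum_Icc ha hA hA0).symm.trans h1)
  have h3 : ∀ v : ℕ → ℝ, ((fun _ => (m.real A * m.real A)⁻¹) * fun N => m.real A * m.real A * v N)
      = v := fun v => by
    ext N
    simp only [Pi.mul_apply]
    rw [inv_mul_cancel_left₀ hv]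
  rwa [h3, h3] at h2

/-- The weights may be signed, so `∑ u_n ~ a(N)` alone does not bound `∑ |u_n|`. Instead `m(A)²
|u_n|` is at most `m(A ∩ T⁻ⁿ A)` plus the mixing error, and these sums are asymptotically `m(A)²
a(N)`. -/
theorem eventually_sum_abs_weights_le (hT : IsWeaklyRationallyErgodic m T R a)
    (ha : Tendsto a atTop atTop) {u : ℕ → ℝ} {A : Set X} (hA : A ∈ R) (hA0 : 0 < m.real A)
    (hu : Tendsto (fun N : ℕ => (∑ n ∈ Finset.Icc 1 N,
        |m.real (A ∩ T^[n] ⁻¹' A) - m.real A * m.real A * u n|) / a N) atTop (𝓝 0)) :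
    ∀ᶠ N in atTop, ∑ n ∈ Finset.Icc 1 N, |u n| ≤ 2 * a N := by
  have hv : 0 < m.real A * m.real A := by positivity
  have h := (hT.tendsto_Icc_div ha hA hA).add hu
  filter_upwards [h.eventually_lt_const
    (show m.real A * m.real A + 0 < 2 * (m.real A * m.real A) by linarith),
    eventually_ge_atTop 1] with N hN hN1
  rw [← add_div, div_lt_iff₀ (hT.pos N hN1), ← Finset.sum_add_distrib] at hN
  have h1 : m.real A * m.real A * ∑ n ∈ Finset.Icc 1 N, |u n|
      ≤ m.real A * m.real A * (2 * a N) := by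
    rw [Finset.mul_sum]
    refine le_trans (Finset.sum_le_sum fun n _ => ?_) (hN.le.trans_eq (by ring))
    have h2 : 0 ≤ m.real (A ∩ T^[n] ⁻¹' A) := measureReal_nonneg
    have h3 := abs_sub_abs_le_abs_sub (m.real A * m.real A * u n) (m.real (A ∩ T^[n] ⁻¹' A))
    rw [abs_sub_comm, abs_of_nonneg h2, abs_mul, abs_of_pos hv] at h3
    linarith
  exact le_of_mul_le_mul_left h1 hv

/-- Rational weak mixing along one dense hereditary ring extends to the ring of the return
sequence. -/
theorem tendsto_sum_abs_sub_weights (hT : IsWeaklyRationallyErgodic m T R a)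
    (ha : Tendsto a atTop atTop) {u : ℕ → ℝ} {R' : Set (Set X)}
    (hR' : IsDenseInvariantHereditaryRing m T R')
    (hu : ∀ A ∈ R', ∀ B ∈ R', Tendsto (fun N : ℕ => (∑ n ∈ Finset.Icc 1 N,
        |m.real (A ∩ T^[n] ⁻¹' B) - m.real A * m.real B * u n|) / a N) atTop (𝓝 0))
    (hu2 : ∀ᶠ N in atTop, ∑ n ∈ Finset.Icc 1 N, |u n| ≤ 2 * a N)
    {B C : Set X} (hB : B ∈ R) (hC : C ∈ R) :
    Tendsto (fun N : ℕ => (∑ n ∈ Finset.Icc 1 N,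
        |m.real (B ∩ T^[n] ⁻¹' C) - m.real B * m.real C * u n|) / a N) atTop (𝓝 0) := by
  have hBm := hT.ring.measurableSet B hB
  have hBt := hT.ring.measure_lt_top B hB
  have hCm := hT.ring.measurableSet C hC
  have hCt := hT.ring.measure_lt_top C hC
  rw [tendsto_order]
  refine ⟨fun r hr => ?_, fun r hr => ?_⟩
  · filter_upwards [eventually_ge_atTop 1] with n hn
    exact hr.trans_le (div_nonneg (Finset.sum_nonneg fun _ _ => abs_nonneg _) (hT.pos n hn).le)
  have hb0 : 0 ≤ m.real B := measureReal_nonneg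
  have hc0 : 0 ≤ m.real C := measureReal_nonneg
  -- One third of `r` pays for the lost visits and the mixing error on `B'`, `C'`; two thirds pay
  -- for the change of `m(B) m(C)`, multiplied by `∑ |u_n| ≤ 2 a(N)`.
  set η := r / (3 * (m.real B + m.real C + 1)) with hη
  have hη0 : 0 < η := by positivity
  have hηr : 3 * (η * (m.real B + m.real C + 1)) = r := by
    rw [hη]
    field_simp
  obtain ⟨B', hB', hBB', hBη⟩ := hR'.exists_subset_sdiff_lt hBm hBt hη0
  obtain ⟨C', hC', hCC', hCη⟩ := hR'.exists_subset_sdiff_lt hCm hCt hη0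
  have hB'm := hR'.measurableSet B' hB'
  have hC'm := hR'.measurableSet C' hC'
  -- `B'` and `C'` are only known to lie in `R'`, but the remainders inherit membership in `R`, so
  -- weak rational ergodicity counts the visits lost.
  have hdB : B \ B' ∈ R := hT.ring.hereditary B hB _ (hBm.diff hB'm) Set.sdiff_subset
  have hdC : C \ C' ∈ R := hT.ring.hereditary C hC _ (hCm.diff hC'm) Set.sdiff_subset
  have hlim := ((hT.tendsto_Icc_div ha hdB hC).add (hT.tendsto_Icc_div ha hB hdC)).add
    (hu B' hB' C' hC')
  have hlt : m.real (B \ B') * m.real C + m.real B * m.real (C \ C') + 0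
      < η * (m.real B + m.real C + 1) := by nlinarith
  have hB'0 : 0 ≤ m.real B' := measureReal_nonneg
  have hC'0 : 0 ≤ m.real C' := measureReal_nonneg
  have hmB := measureReal_sdiff hBB' hB'm hBt.ne
  have hmC := measureReal_sdiff hCC' hC'm hCt.ne
  have hBle : m.real B' ≤ m.real B := measureReal_mono hBB' hBt.ne
  have hCle : m.real C' ≤ m.real C := measureReal_mono hCC' hCt.ne
  have hprod0 : 0 ≤ m.real B * m.real C - m.real B' * m.real C' := by nlinarith
  have hprod : m.real B * m.real C - m.real B' * m.real C' ≤ η * (m.real B + m.real C + 1) := by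
    nlinarith
  have hterm : ∀ n, |m.real (B ∩ T^[n] ⁻¹' C) - m.real B * m.real C * u n|
      ≤ m.real ((B \ B') ∩ T^[n] ⁻¹' C) + m.real (B ∩ T^[n] ⁻¹' (C \ C'))
        + |m.real (B' ∩ T^[n] ⁻¹' C') - m.real B' * m.real C' * u n|
        + (m.real B * m.real C - m.real B' * m.real C') * |u n| := by
    intro n
    have hft : ∀ s : Set X, s ⊆ B → m s ≠ ⊤ := fun s hs => ((measure_mono hs).trans_lt hBt).ne
    have h1 : m.real (B' ∩ T^[n] ⁻¹' C') ≤ m.real (B ∩ T^[n] ⁻¹' C) :=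
      measureReal_mono (Set.inter_subset_inter hBB' (Set.preimage_mono hCC'))
        (hft _ Set.inter_subset_left)
    have h2 : m.real (B ∩ T^[n] ⁻¹' C) ≤ m.real ((B \ B') ∩ T^[n] ⁻¹' C)
        + m.real (B ∩ T^[n] ⁻¹' (C \ C')) + m.real (B' ∩ T^[n] ⁻¹' C') := by
      refine le_trans (measureReal_mono ?_ (hft _ ?_)) ((measureReal_union_le _ _).trans
        (add_le_add (measureReal_union_le _ _) le_rfl))
      · rintro x ⟨hxB, hxC⟩
        by_cases hx1 : x ∈ B'
        · by_cases hx2 : T^[n] x ∈ C'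
          · exact Or.inr ⟨hx1, hx2⟩
          · exact Or.inl (Or.inr ⟨hxB, hxC, hx2⟩)
        · exact Or.inl (Or.inl ⟨⟨hxB, hx1⟩, hxC⟩)
      · exact Set.union_subset (Set.union_subset (Set.inter_subset_left.trans Set.sdiff_subset)
          Set.inter_subset_left) (Set.inter_subset_left.trans hBB')
    have h3 : m.real (B ∩ T^[n] ⁻¹' C) - m.real B * m.real C * u n
        = (m.real (B ∩ T^[n] ⁻¹' C) - m.real (B' ∩ T^[n] ⁻¹' C'))
          + (m.real (B' ∩ T^[n] ⁻¹' C') - m.real B' * m.real C' * u n)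
          + -((m.real B * m.real C - m.real B' * m.real C') * u n) := by ring
    rw [h3]
    refine (abs_add_three _ _ _).trans ?_
    rw [abs_neg, abs_mul, abs_of_nonneg hprod0, abs_of_nonneg (sub_nonneg.2 h1)]
    linarith
  filter_upwards [hlim.eventually_lt_const hlt, hu2, eventually_ge_atTop 1] with N h1 h2 hN1
  have haN := hT.pos N hN1
  rw [← add_div, ← add_div, div_lt_iff₀ haN] at h1
  rw [div_lt_iff₀ haN]
  have h4 := Finset.sum_le_sum fun n (_ : n ∈ Finset.Icc 1 N) => hterm n
  rw [Finset.sum_add_distrib, Finset.sum_add_distrib, Finset.sum_add_distrib,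
    ← Finset.mul_sum] at h4
  have h5 : (m.real B * m.real C - m.real B' * m.real C') * ∑ n ∈ Finset.Icc 1 N, |u n|
      ≤ η * (m.real B + m.real C + 1) * (2 * a N) := by gcongr
  rw [← hηr]
  linarith

end IsWeaklyRationallyErgodic

/-! ### Assembly -/

theorem proposition6 {X : Type*} [TopologicalSpace X] [PolishSpace X] [MeasurableSpace X]
    [BorelSpace X] (m : Measure X) [SigmaFinite m] [NullSingletonClass m] (hm : m ≠ 0)
    (T : X → X) (R : Set (Set X)) (a : ℕ → ℝ)
    (hT : IsWeaklyRationallyErgodic m T R a)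
    (hconv : ∀ f : X → ℝ, Integrable f m →
      TendstoInMeasureOnFinite m (fun n x => birkhoffSum T f n x / a n) (fun _ => ∫ x, f x ∂m)) :
    (∀ f : X → ℝ, Integrable f m → 0 ≤ᵐ[m] f → ∀ g : ℝ≥0 →ᵇ ℝ, ∀ A ∈ R, ∀ B ∈ R,
      Tendsto (fun n : ℕ => (1 / a n) * ∑ k ∈ Finset.Icc 1 n,
        |(∫ x in A, g (birkhoffSum T f k x / a k).toNNReal *
              B.indicator (fun _ => (1 : ℝ)) (T^[k] x) ∂m)
            - g (∫ x, f x ∂m).toNNReal * m.real (A ∩ T^[k] ⁻¹' B)|)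
        atTop (𝓝 0)) ∧
    (∀ u : ℕ → ℝ, IsRationallyWeaklyMixing m T u →
      a ~[atTop] (fun N : ℕ => ∑ n ∈ Finset.Icc 1 N, u n) ∧
      ∀ f : X → ℝ, Integrable f m → 0 ≤ᵐ[m] f → ∀ g : ℝ≥0 →ᵇ ℝ, ∀ B ∈ R, ∀ C ∈ R,
        Tendsto (fun N : ℕ => (1 / a N) * ∑ n ∈ Finset.Icc 1 N,
          |(∫ x in B ∩ T^[n] ⁻¹' C, g (birkhoffSum T f n x / a n).toNNReal ∂m)
            - m.real B * m.real C * g (∫ x, f x ∂m).toNNReal * u n|)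
          atTop (𝓝 0)) := by
  have ha := hT.tendsto_atTop hm
  refine ⟨fun f hf hf0 g A hA B hB => ?_, fun u ⟨_, R', hR', hu⟩ => ?_⟩
  · refine (hT.tendsto_sum_abs_setIntegral_sub hm hconv hf hf0 g hA hB).congr fun n => ?_
    rw [one_div, div_eq_inv_mul]
    congr 1
    refine Finset.sum_congr rfl fun k _ => ?_
    have hBk := hT.measurableSet_preimage_iterate (hT.ring.measurableSet B hB) k
    rw [← setIntegral_indicator hBk]
    congr 3
    ext x
    by_cases hx : T^[k] x ∈ B
    · rw [Set.indicator_of_mem (show x ∈ T^[k] ⁻¹' B from hx), Set.indicator_of_mem hx, mul_one]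
    · rw [Set.indicator_of_notMem (show x ∉ T^[k] ⁻¹' B from hx), Set.indicator_of_notMem hx,
        mul_zero]
  · obtain ⟨A₁, hA₁, hA₁0, -⟩ := hR'.exists_measureReal_pos_lt hm one_pos
    -- The rings may differ; heredity of `R'` puts a positive-measure set in both, where the return
    -- sequence and the weights can be compared.
    obtain ⟨A, hA, hAA, hAlt⟩ := hT.ring.exists_subset_sdiff_lt (hR'.measurableSet A₁ hA₁)
      (hR'.measure_lt_top A₁ hA₁) hA₁0
    have hAm := hT.ring.measurableSet A hA
    have hA' : A ∈ R' := hR'.hereditary A₁ hA₁ A hAm hAA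
    have hA0 : 0 < m.real A := by
      rw [measureReal_sdiff hAA hAm (hR'.measure_lt_top A₁ hA₁).ne] at hAlt
      linarith
    have heq := hT.isEquivalent_sum_weights ha hA hA0 (hu A hA' A hA')
    have hu' : ∀ B ∈ R', ∀ C ∈ R', Tendsto (fun N : ℕ => (∑ n ∈ Finset.Icc 1 N,
        |m.real (B ∩ T^[n] ⁻¹' C) - m.real B * m.real C * u n|) / a N) atTop (𝓝 0) :=
      fun B hB C hC => ((hu B hB C hC).trans_isBigO heq.symm.isBigO).tendsto_div_nhds_zero
    refine ⟨heq, fun f hf hf0 g B hB C hC => ?_⟩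
    have h1 := hT.tendsto_sum_abs_setIntegral_sub hm hconv hf hf0 g hB hC
    have h2 := hT.tendsto_sum_abs_sub_weights ha hR' hu'
      (hT.eventually_sum_abs_weights_le ha hA hA0 (hu' A hA' A hA')) hB hC
    -- With `I_n` the integral and `γ = g(m(f))`, the split is `I_n - m(B) m(C) γ u_n = (I_n - γ m(B
    -- ∩ T⁻ⁿ C)) + γ (m(B ∩ T⁻ⁿ C) - m(B) m(C) u_n)`.
    have h3 := h1.add (h2.const_mul |g (∫ x, f x ∂m).toNNReal|)
    rw [mul_zero, add_zero] at h3
    refine squeeze_zero' ?_ ?_ h3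
    · filter_upwards [eventually_ge_atTop 1] with n hn
      have := hT.pos n hn
      exact mul_nonneg (by positivity) (Finset.sum_nonneg fun _ _ => abs_nonneg _)
    · filter_upwards [eventually_ge_atTop 1] with N hN
      rw [one_div, inv_mul_eq_div, mul_div_assoc', ← add_div]
      refine div_le_div_of_nonneg_right ?_ (hT.pos N hN).le
      rw [Finset.mul_sum, ← Finset.sum_add_distrib]
      refine Finset.sum_le_sum fun n _ => ?_
      rw [← abs_mul]
      refine le_trans (le_of_eq ?_) (abs_add_le _ _)
      congr 1
      ring
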